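/- Let $R$ be an associative ring with $1$, let $\delta\colon R\to R$ be a derivation (additive, $\delta(rs)=\delta(r)s+r\delta(s)$), let $M$ be a right $R$-module, and let $d\colon M\to M$ be a $\delta$-derivation (additive, $d(xr)=d(x)r+x\delta(r)$). A hereditary torsion theory for right $R$-modules is identified with its Gabriel filter $\mathfrak F$ of right ideals; its torsion submodule is $t(M)=\{m\in M : \mathrm{ann}_r(m)\in\mathfrak F\}$, and it is faithful if $t(R)=0$. It is differential if for every derivation $\partial$ of $R$ and every $I\in\mathfrak F$ there is $J\in\mathfrak F$ with $\partial(J)\subseteq I$. The module of quotients is $M_{\mathfrak F}=\varinjlim_{I\in\mathfrak F}\mathrm{Hom}_R(I,M/t(M))$, with canonical map $q\colon M\to M_{\mathfrak F}$; $R_{\mathfrak F}$ is a ring, the right ring of quotients, and $M_{\mathfrak F}$ is a right $R_{\mathfrak F}$-module. If $\mathfrak F_1\subseteq\mathfrak F_2$, there is a canonical map $q_{12}\colon M_{\mathfrak F_1}\to M_{\mathfrak F_2}$ with $q_{12}q_1=q_2$. An extension of $d$ to $M_{\mathfrak F}$ is a $\delta$-derivation $D$ of $M_{\mathfrak F}$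 with $Dq=qd$; an extension of $\delta$ to the ring $R_{\mathfrak F}$ is a derivation $D$ of the ring $R_{\mathfrak F}$ with $Dq=q\delta$. We say that the extensions with respect to $\mathfrak F_1$ and $\mathfrak F_2$ agree if $\mathfrak F_1\subseteq\mathfrak F_2$, there are unique extensions $D_1$ and $D_2$ with respect to $\mathfrak F_1$ and $\mathfrak F_2$, and $q_{12}D_1=D_2q_{12}$. The Lambek torsion theory is the one whose Gabriel filter consists of the dense right ideals; its right ring of quotients is $Q_{\max}(R)$. The Goldie torsion theory is the one whose torsion-free modules are the nonsingular modules (its filter is the smallest Gabriel filter containing all essential right ideals); its right ring of quotients is $Q_{\mathrm{Gold}}(R)$. A filter $\mathfrak F$ is perfect if the canonical map $N\otimes_R R_{\mathfrak F}\to N_{\mathfrak F}$ is bijective for every right $R$-module $N$; the maximal perfect torsion theory is given by the largest faithful perfect filter, and its right ring of quotients is the total right ring of quotients $Q_{\mathrm{tot}}(R)$. $R$ is right Ore if $rT\cap tR\neq\emptyset$ for all $r\in R$ and $t\in T$, where $T$ is the set of regular elements; the classical torsion theory is then the one in which a module is torsion iff each of its elements is annihilated by some $t\in T$, and its right ring of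 quotients is $Q_{\mathrm{cl}}(R)$. Then: 1. The extension of $\delta$ to any right ring of quotients with respect to a hereditary and faithful torsion theory agrees with the extension of $\delta$ to $Q_{\max}(R)$. In particular, the extensions to $Q_{\mathrm{tot}}(R)$ and $Q_{\max}(R)$ agree. 2. The extension of $d$ to any module of quotients of $M$ with respect to a differential, hereditary and faithful torsion theory agrees with the extension of $d$ to the module of quotients with respect to the Lambek torsion theory. In particular, the extensions of $d$ to the modules of quotients of $M$ with respect to the maximal perfect and the Lambek torsion theory agree. 3. If $R$ is right Ore, then the extension of $\delta$ to $Q_{\mathrm{cl}}(R)$ agrees with the extension to $Q_{\max}(R)$ and with the extension to $Q_{\mathrm{tot}}(R)$. 4. The extensions of $\delta$ to $Q_{\max}(R)$ and $Q_{\mathrm{Gold}}(R)$ agree. Moreover, the extension of $\delta$ to any right ring of quotients with respect to a hereditary and faithful torsion theory agrees with the extension of $\delta$ to $Q_{\mathrm{Gold}}(R)$. -/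

import Mathlib

open MulOpposite TensorProduct

universe u v w

/-! Right `R`-modules are modules over `Rᵐᵒᵖ`, with `op r • m` for `m r`; right ideals of `R` are
the `Rᵐᵒᵖ`-submodules of `R`. -/

/-- A derivation of a (not necessarily commutative) ring. -/
structure IsRingDerivation {R : Type u} [Ring R] (δ : R → R) : Prop where
  map_add : ∀ r s, δ (r + s) = δ r + δ s
  map_mul : ∀ r s, δ (r * s) = δ r * s + r * δ s

/-- A `δ`-derivation of a right `R`-module: `d (x r) = d (x) r + x δ(r)`. -/
structure IsModuleDerivation {R : Type u} [Ring R] {M : Type v} [AddCommGroup M] [Module Rᵐᵒᵖ M]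
    (δ : R → R) (d : M → M) : Prop where
  map_add : ∀ x y, d (x + y) = d x + d y
  map_smul : ∀ (x : M) (r : R), d (op r • x) = op r • d x + op (δ r) • x

/-- Left multiplication `L_m : R → M`, `r ↦ m r`, as a map of right modules. -/
def leftMulMap {R : Type u} [Ring R] {M : Type v} [AddCommGroup M] [Module Rᵐᵒᵖ M] (m : M) :
    R →ₗ[Rᵐᵒᵖ] M where
  toFun r := op r • m
  map_add' r s := by rw [op_add, add_smul]
  map_smul' c r := by
    rw [show (c • r : R) = r * unop c from rfl, op_mul, op_unop, mul_smul]; rfl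

@[simp] theorem leftMulMap_apply {R : Type u} [Ring R] {M : Type v} [AddCommGroup M]
    [Module Rᵐᵒᵖ M] (m : M) (r : R) : leftMulMap m r = op r • m := rfl

/-- The right annihilator `{r | m r = 0}` of an element. -/
def rightAnn {R : Type u} [Ring R] {M : Type v} [AddCommGroup M] [Module Rᵐᵒᵖ M] (m : M) :
    Submodule Rᵐᵒᵖ R :=
  LinearMap.ker (leftMulMap m)

/-- The right ideal `(I : a) = {r | a r ∈ I}`. -/
def rightColon {R : Type u} [Ring R] (I : Submodule Rᵐᵒᵖ R) (a : R) : Submodule Rᵐᵒᵖ R :=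
  I.comap (leftMulMap a)

@[simp] theorem mem_rightAnn {R : Type u} [Ring R] {M : Type v} [AddCommGroup M] [Module Rᵐᵒᵖ M]
    {m : M} {r : R} : r ∈ rightAnn m ↔ op r • m = 0 := Iff.rfl

@[simp] theorem mem_rightColon {R : Type u} [Ring R] {I : Submodule Rᵐᵒᵖ R} {a r : R} :
    r ∈ rightColon I a ↔ a * r ∈ I := Iff.rfl

theorem rightIdeal_mul_mem {R : Type u} [Ring R] {I : Submodule Rᵐᵒᵖ R} {a : R} (h : a ∈ I)
    (r : R) : a * r ∈ I := I.smul_mem (op r) h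

/-- A (right) Gabriel filter on `R`. -/
@[ext]
structure GabrielFilter (R : Type u) [Ring R] where
  sets : Set (Submodule Rᵐᵒᵖ R)
  top_mem : ⊤ ∈ sets
  mem_of_le : ∀ {I J : Submodule Rᵐᵒᵖ R}, I ∈ sets → I ≤ J → J ∈ sets
  inf_mem : ∀ {I J : Submodule Rᵐᵒᵖ R}, I ∈ sets → J ∈ sets → I ⊓ J ∈ sets
  colon_mem : ∀ {I : Submodule Rᵐᵒᵖ R}, I ∈ sets → ∀ a : R, rightColon I a ∈ sets
  mem_of_colon : ∀ {I J : Submodule Rᵐᵒᵖ R}, I ∈ sets → (∀ a ∈ I, rightColon J a ∈ sets) → J ∈ sets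

namespace GabrielFilter

section Basic

variable {R : Type u} [Ring R]

/-- Gabriel filters are ordered by inclusion. -/
instance : PartialOrder (GabrielFilter R) where
  le F G := F.sets ⊆ G.sets
  le_refl _ := subset_refl _
  le_trans _ _ _ h h' := Set.Subset.trans h h'
  le_antisymm _ _ h h' := GabrielFilter.ext (Set.Subset.antisymm h h')

/-- The intersection of a set of Gabriel filters. -/
def inter (S : Set (GabrielFilter R)) : GabrielFilter R where
  sets := {I | ∀ F ∈ S, I ∈ F.sets}
  top_mem F _ := F.top_mem
  mem_of_le h hle F hF := F.mem_of_le (h F hF) hle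
  inf_mem h h' F hF := F.inf_mem (h F hF) (h' F hF)
  colon_mem h a F hF := F.colon_mem (h F hF) a
  mem_of_colon h h' F hF := F.mem_of_colon (h F hF) fun a ha => h' a ha F hF

/-- The join of a set of Gabriel filters: the smallest one which contains all of them. -/
def join (S : Set (GabrielFilter R)) : GabrielFilter R := inter (upperBounds S)

theorem isLUB_join (S : Set (GabrielFilter R)) : IsLUB S (join S) :=
  ⟨fun _ hF _ hI _ hG => hG hF hI, fun G hG _ hI => hI G hG⟩

/-- The torsion submodule `t(M)`: the elements whose right annihilator is in the filter. -/
def torsion (F : GabrielFilter R) (M : Type v) [AddCommGroup M] [Module Rᵐᵒᵖ M] :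
    Submodule Rᵐᵒᵖ M where
  carrier := {m | rightAnn m ∈ F.sets}
  zero_mem' := F.mem_of_le F.top_mem fun r _ => by simp
  add_mem' {a b} ha hb := F.mem_of_le (F.inf_mem ha hb) fun r hr => by
    have h1 : op r • a = 0 := hr.1
    have h2 : op r • b = 0 := hr.2
    simp [smul_add, h1, h2]
  smul_mem' c m hm := F.mem_of_le (F.colon_mem hm (unop c)) fun r hr => by
    have h1 : op (unop c * r) • m = 0 := hr
    rw [op_mul, op_unop, mul_smul] at h1
    exact h1

theorem mem_torsion {F : GabrielFilter R} {M : Type v} [AddCommGroup M] [Module Rᵐᵒᵖ M] {m : M} :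
    m ∈ F.torsion M ↔ rightAnn m ∈ F.sets := Iff.rfl

/-- The torsion theory of `F` is faithful: `t(R) = 0`. -/
def IsFaithful (F : GabrielFilter R) : Prop := F.torsion R = ⊥

/-- `F` is differential: for every derivation `δ` and every `I ∈ F` there is `J ∈ F` with
`δ(J) ⊆ I`. -/
def IsDifferential (F : GabrielFilter R) : Prop :=
  ∀ δ : R → R, IsRingDerivation δ → ∀ I ∈ F.sets, ∃ J ∈ F.sets, ∀ r ∈ J, δ r ∈ I

/-- `M / t(M)` is torsion-free. -/
theorem eq_zero_of_rightAnn_mem (F : GabrielFilter R) {M : Type v} [AddCommGroup M]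
    [Module Rᵐᵒᵖ M] {y : M ⧸ F.torsion M} (h : rightAnn y ∈ F.sets) : y = 0 := by
  obtain ⟨m, rfl⟩ := Submodule.mkQ_surjective _ y
  rw [Submodule.mkQ_apply, Submodule.Quotient.mk_eq_zero, mem_torsion]
  refine F.mem_of_colon h fun a ha => ?_
  have ha' : op a • m ∈ F.torsion M := by
    rw [← Submodule.Quotient.mk_eq_zero, Submodule.Quotient.mk_smul]
    exact ha
  refine F.mem_of_le (mem_torsion.1 ha') fun r hr => ?_
  have h1 : op r • op a • m = 0 := hr
  rw [← mul_smul, ← op_mul] at h1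
  exact h1

end Basic

/-! ### Modules of quotients -/

section Quotients

variable {R : Type u} [Ring R] (F : GabrielFilter R)
variable (M : Type v) [AddCommGroup M] [Module Rᵐᵒᵖ M]

/-- Homomorphisms of right modules `I → M / t(M)` with `I ∈ F`. -/
def PreQuot : Type (max u v) := {f : R →ₗ.[Rᵐᵒᵖ] (M ⧸ F.torsion M) // f.domain ∈ F.sets}

variable {M}

/-- `f` is defined at `x` and has the value `y` there. -/
def Val {N : Type w} [AddCommGroup N] [Module Rᵐᵒᵖ N] (f : R →ₗ.[Rᵐᵒᵖ] N) (x : R) (y : N) : Prop :=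
  ∃ h : x ∈ f.domain, f ⟨x, h⟩ = y

section Val

variable {N : Type w} [AddCommGroup N] [Module Rᵐᵒᵖ N] {f g : R →ₗ.[Rᵐᵒᵖ] N} {x x' : R} {y y' : N}

theorem Val.unique (h : Val f x y) (h' : Val f x y') : y = y' := by
  obtain ⟨_, rfl⟩ := h
  obtain ⟨_, rfl⟩ := h'
  rfl

theorem Val.add (h : Val f x y) (h' : Val f x' y') : Val f (x + x') (y + y') := by
  obtain ⟨h1, rfl⟩ := h
  obtain ⟨h2, rfl⟩ := h'
  exact ⟨add_mem h1 h2, f.map_add ⟨x, h1⟩ ⟨x', h2⟩⟩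

theorem Val.smul (h : Val f x y) (c : Rᵐᵒᵖ) : Val f (c • x) (c • y) := by
  obtain ⟨h1, rfl⟩ := h
  exact ⟨Submodule.smul_mem _ c h1, f.map_smul c ⟨x, h1⟩⟩

theorem Val.pAdd (h : Val f x y) (h' : Val g x y') : Val (f + g) x (y + y') := by
  obtain ⟨h1, rfl⟩ := h
  obtain ⟨h2, rfl⟩ := h'
  exact ⟨⟨h1, h2⟩, rfl⟩

theorem Val.pNeg (h : Val f x y) : Val (-f) x (-y) := by
  obtain ⟨h1, rfl⟩ := h
  exact ⟨h1, rfl⟩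

theorem val_zero (x : R) : Val (0 : R →ₗ.[Rᵐᵒᵖ] N) x 0 := ⟨trivial, rfl⟩

theorem val_of_mem (h : x ∈ f.domain) : Val f x (f ⟨x, h⟩) := ⟨h, rfl⟩

end Val

/-- Two homomorphisms `I → M / t(M)` and `J → M / t(M)` represent the same element of the direct
limit iff they agree on some `K ∈ F` (equivalently, if their equalizer is in `F`). -/
instance preQuotSetoid : Setoid (F.PreQuot M) where
  r f g := f.1.eqLocus g.1 ∈ F.sets
  iseqv :=
    { refl := fun f => F.mem_of_le f.2 fun _ hx => ⟨hx, hx, rfl⟩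
      symm := fun h => F.mem_of_le h fun _ ⟨h1, h2, h3⟩ => ⟨h2, h1, h3.symm⟩
      trans := fun h h' => F.mem_of_le (F.inf_mem h h')
        fun _ ⟨⟨h1, _, h3⟩, ⟨_, h5, h6⟩⟩ => ⟨h1, h5, h3.trans h6⟩ }

variable (M) in
/-- The module of quotients `M_F`, the direct limit of `Hom(I, M / t(M))` over `I ∈ F`. -/
def Quotients : Type (max u v) := Quotient (F.preQuotSetoid (M := M))

variable {F}

theorem quot_eq {f g : F.PreQuot M} {K : Submodule Rᵐᵒᵖ R} (hK : K ∈ F.sets)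
    (h : ∀ x ∈ K, ∃ y, Val f.1 x y ∧ Val g.1 x y) :
    (Quotient.mk _ f : F.Quotients M) = Quotient.mk _ g :=
  Quotient.sound (F.mem_of_le hK fun x hx => by
    obtain ⟨y, ⟨h1, h2⟩, ⟨h3, h4⟩⟩ := h x hx
    exact ⟨h1, h3, h2.trans h4.symm⟩)

theorem exists_of_rel {f g : F.PreQuot M} (h : f ≈ g) :
    ∃ K ∈ F.sets, ∀ x ∈ K, ∃ y, Val f.1 x y ∧ Val g.1 x y :=
  ⟨_, h, fun _ ⟨h1, h2, h3⟩ => ⟨_, ⟨h1, rfl⟩, ⟨h2, h3.symm⟩⟩⟩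

/-- Addition of representatives: `f + g` on the intersection of the domains. -/
def preAdd (f g : F.PreQuot M) : F.PreQuot M := ⟨f.1 + g.1, F.inf_mem f.2 g.2⟩

/-- Negation of representatives. -/
def preNeg (f : F.PreQuot M) : F.PreQuot M := ⟨-f.1, f.2⟩

instance : Zero (F.Quotients M) := ⟨Quotient.mk _ ⟨0, F.top_mem⟩⟩

instance : Add (F.Quotients M) where
  add := Quotient.map₂ preAdd fun f f' h g g' h' => by
    obtain ⟨K, hK, hf⟩ := exists_of_rel h
    obtain ⟨L, hL, hg⟩ := exists_of_rel h'
    refine Quotient.exact (quot_eq (F.inf_mem hK hL) fun x hx => ?_)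
    obtain ⟨y, h1, h2⟩ := hf x hx.1
    obtain ⟨z, h3, h4⟩ := hg x hx.2
    exact ⟨y + z, h1.pAdd h3, h2.pAdd h4⟩

instance : Neg (F.Quotients M) where
  neg := Quotient.map preNeg fun f f' h => by
    obtain ⟨K, hK, hf⟩ := exists_of_rel h
    refine Quotient.exact (quot_eq hK fun x hx => ?_)
    obtain ⟨y, h1, h2⟩ := hf x hx
    exact ⟨-y, h1.pNeg, h2.pNeg⟩

/-- The pointwise additive group structure of the direct limit. -/
instance : AddCommGroup (F.Quotients M) where
  add_assoc a b c := by
    induction a using Quotient.inductionOn with | _ f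
    induction b using Quotient.inductionOn with | _ g
    induction c using Quotient.inductionOn with | _ k
    exact congrArg (Quotient.mk _) (Subtype.ext (add_assoc f.1 g.1 k.1))
  add_comm a b := by
    induction a using Quotient.inductionOn with | _ f
    induction b using Quotient.inductionOn with | _ g
    exact congrArg (Quotient.mk _) (Subtype.ext (add_comm f.1 g.1))
  zero_add a := by
    induction a using Quotient.inductionOn with | _ f
    exact congrArg (Quotient.mk _) (Subtype.ext (zero_add f.1))
  add_zero a := by
    induction a using Quotient.inductionOn with | _ f
    exact congrArg (Quotient.mk _) (Subtype.ext (add_zero f.1))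
  neg_add_cancel a := by
    induction a using Quotient.inductionOn with | _ f
    refine quot_eq f.2 fun x hx => ⟨0, ?_, val_zero x⟩
    have h := (val_of_mem hx).pNeg.pAdd (val_of_mem hx)
    rw [neg_add_cancel] at h
    exact h
  nsmul := nsmulRec
  zsmul := zsmulRec

/-- For `L ∈ F` and `g : J → M / t(M)`, the elements `x ∈ J` such that `g x` is the class of
an element of the submodule `P`. -/
def preim (g : R →ₗ.[Rᵐᵒᵖ] (M ⧸ F.torsion M)) (P : Submodule Rᵐᵒᵖ M) : Submodule Rᵐᵒᵖ R where
  carrier := {x | ∃ y ∈ P, Val g x ((F.torsion M).mkQ y)}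
  zero_mem' := ⟨0, P.zero_mem, by
    rw [map_zero]; exact ⟨zero_mem _, g.map_zero⟩⟩
  add_mem' := fun ⟨y, hy, h⟩ ⟨z, hz, h'⟩ => ⟨y + z, P.add_mem hy hz, by
    rw [_root_.map_add]; exact h.add h'⟩
  smul_mem' c x := fun ⟨y, hy, h⟩ => ⟨c • y, P.smul_mem c hy, by
    rw [_root_.map_smul]; exact h.smul c⟩

theorem preim_mem {g : R →ₗ.[Rᵐᵒᵖ] (R ⧸ F.torsion R)} (hg : g.domain ∈ F.sets)
    {L : Submodule Rᵐᵒᵖ R} (hL : L ∈ F.sets) : preim g L ∈ F.sets := by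
  refine F.mem_of_colon hg fun x hx => ?_
  obtain ⟨r, hr⟩ := Submodule.mkQ_surjective _ (g ⟨x, hx⟩)
  refine F.mem_of_le (F.colon_mem hL r) fun s hs => ⟨r * s, hs, ?_⟩
  have h := (show Val g x _ from ⟨hx, hr.symm⟩).smul (op s)
  rw [← _root_.map_smul] at h
  exact h

/-- A map from a right ideal in `F` to a torsion-free module kills torsion. -/
theorem val_congr {f : R →ₗ.[Rᵐᵒᵖ] (M ⧸ F.torsion M)} {a b : R} {y z : M ⧸ F.torsion M}
    (ha : Val f a y) (hb : Val f b z)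
    (hab : (F.torsion R).mkQ a = (F.torsion R).mkQ b) : y = z := by
  have h1 : a - b ∈ F.torsion R := (Submodule.Quotient.eq _).1 hab
  refine sub_eq_zero.1 (F.eq_zero_of_rightAnn_mem (F.mem_of_le (mem_torsion.1 h1) fun r hr => ?_))
  have h2 : Val f (a - b) (y - z) := by
    have h3 := ha.add (hb.smul (-1))
    rwa [neg_smul, one_smul, neg_smul, one_smul, ← sub_eq_add_neg, ← sub_eq_add_neg] at h3
  have h4 := h2.smul (op r)
  have h5 : op r • (a - b) = 0 := hr
  rw [h5] at h4
  exact h4.unique ⟨zero_mem _, f.map_zero⟩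

/-- The composite of `g : J → R / t(R)` with the map `(I + t(R)) / t(R) → M / t(M)` which is
induced by `f : I → M / t(M)`, defined on all `x ∈ J` with `g x ∈ (I + t(R)) / t(R)`. -/
noncomputable def pComp (f : R →ₗ.[Rᵐᵒᵖ] (M ⧸ F.torsion M)) (g : R →ₗ.[Rᵐᵒᵖ] (R ⧸ F.torsion R)) :
    R →ₗ.[Rᵐᵒᵖ] (M ⧸ F.torsion M) where
  domain := preim g f.domain
  toFun :=
    { toFun := fun x => f ⟨x.2.choose, x.2.choose_spec.1⟩
      map_add' := fun x y => by
        refine val_congr (val_of_mem _) ((val_of_mem x.2.choose_spec.1).add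
          (val_of_mem y.2.choose_spec.1)) ?_
        rw [_root_.map_add]
        exact (x + y).2.choose_spec.2.unique (x.2.choose_spec.2.add y.2.choose_spec.2)
      map_smul' := fun c x => by
        refine val_congr (val_of_mem _) ((val_of_mem x.2.choose_spec.1).smul c) ?_
        rw [_root_.map_smul]
        exact (c • x).2.choose_spec.2.unique (x.2.choose_spec.2.smul c) }

theorem Val.pComp {f : R →ₗ.[Rᵐᵒᵖ] (M ⧸ F.torsion M)} {g : R →ₗ.[Rᵐᵒᵖ] (R ⧸ F.torsion R)}
    {x y : R} {z : M ⧸ F.torsion M} (h : Val g x ((F.torsion R).mkQ y)) (h' : Val f y z) :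
    Val (pComp f g) x z := by
  have hx : x ∈ preim g f.domain := ⟨y, h'.1, h⟩
  refine ⟨hx, val_congr (val_of_mem hx.choose_spec.1) h' ?_⟩
  exact hx.choose_spec.2.unique h

/-- Composition of representatives. -/
noncomputable def preComp (f : F.PreQuot M) (g : F.PreQuot R) : F.PreQuot M :=
  ⟨GabrielFilter.pComp f.1 g.1, preim_mem g.2 f.2⟩

/-- The right action `M_F × R_F → M_F`; for `M = R` it is the multiplication of `R_F`. -/
noncomputable def act : F.Quotients M → F.Quotients R → F.Quotients M :=
  Quotient.map₂ preComp fun f f' h g g' h' => by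
    obtain ⟨K, hK, hg⟩ := exists_of_rel h'
    refine Quotient.exact (quot_eq (F.inf_mem hK (preim_mem g.2 h)) fun x hx => ?_)
    obtain ⟨y, ⟨h1, h2, h3⟩, h4⟩ := hx.2
    obtain ⟨z, h5, h6⟩ := hg x hx.1
    obtain rfl := h4.unique h5
    exact ⟨_, h4.pComp ⟨h1, rfl⟩, h6.pComp ⟨h2, h3.symm⟩⟩

/-- The canonical map `q_M : M → M_F`, `m ↦ L_{m + t(M)}`. -/
def toQuot (F : GabrielFilter R) (m : M) : F.Quotients M :=
  Quotient.mk _ ⟨((F.torsion M).mkQ.comp (leftMulMap m)).toPMap ⊤, F.top_mem⟩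

theorem val_toQuot (F : GabrielFilter R) (m : M) (x : R) :
    Val (((F.torsion M).mkQ.comp (leftMulMap m)).toPMap ⊤) x ((F.torsion M).mkQ (op x • m)) :=
  ⟨trivial, rfl⟩

theorem toQuot_add (m n : M) : F.toQuot (m + n) = F.toQuot m + F.toQuot n :=
  quot_eq F.top_mem fun x _ => ⟨_, val_toQuot F (m + n) x, by
    rw [smul_add, _root_.map_add]
    exact (val_toQuot F m x).pAdd (val_toQuot F n x)⟩

theorem act_toQuot (m : M) (r : R) : act (F.toQuot m) (F.toQuot r) = F.toQuot (op r • m) :=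
  quot_eq F.top_mem fun x _ => ⟨_, (val_toQuot F r x).pComp (val_toQuot F m _), by
    rw [smul_eq_mul_unop, unop_op, op_mul, mul_smul]
    exact val_toQuot F (op r • m) x⟩

theorem act_one (a : F.Quotients M) : act a (F.toQuot (1 : R)) = a := by
  induction a using Quotient.inductionOn with | _ f
  refine quot_eq f.2 fun x hx => ⟨_, (val_toQuot F 1 x).pComp ?_, val_of_mem hx⟩
  rw [smul_eq_mul_unop, unop_op, one_mul]
  exact val_of_mem hx

theorem act_assoc (a : F.Quotients M) (b c : F.Quotients R) : act (act a b) c = act a (act b c) := by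
  induction a using Quotient.inductionOn with | _ f
  induction b using Quotient.inductionOn with | _ g
  induction c using Quotient.inductionOn with | _ k
  refine quot_eq (preim_mem k.2 (preim_mem g.2 f.2)) fun x hx => ?_
  obtain ⟨y, ⟨z, hz, hy⟩, h⟩ := hx
  exact ⟨_, h.pComp (hy.pComp (val_of_mem hz)), (h.pComp hy).pComp (val_of_mem hz)⟩

theorem add_act (a b : F.Quotients M) (c : F.Quotients R) : act (a + b) c = act a c + act b c := by
  induction a using Quotient.inductionOn with | _ f
  induction b using Quotient.inductionOn with | _ g
  induction c using Quotient.inductionOn with | _ k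
  refine quot_eq (preim_mem k.2 (F.inf_mem f.2 g.2)) fun x hx => ?_
  obtain ⟨y, hy, h⟩ := hx
  exact ⟨_, h.pComp ((val_of_mem hy.1).pAdd (val_of_mem hy.2)),
    (h.pComp (val_of_mem hy.1)).pAdd (h.pComp (val_of_mem hy.2))⟩

theorem act_add (a : F.Quotients M) (b c : F.Quotients R) : act a (b + c) = act a b + act a c := by
  induction a using Quotient.inductionOn with | _ f
  induction b using Quotient.inductionOn with | _ g
  induction c using Quotient.inductionOn with | _ k
  refine quot_eq (F.inf_mem (preim_mem g.2 f.2) (preim_mem k.2 f.2)) fun x hx => ?_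
  obtain ⟨⟨y, hy, h⟩, ⟨z, hz, h'⟩⟩ := hx
  refine ⟨_, Val.pComp (y := y + z) ?_ ((val_of_mem hy).add (val_of_mem hz)),
    (h.pComp (val_of_mem hy)).pAdd (h'.pComp (val_of_mem hz))⟩
  rw [_root_.map_add]
  exact h.pAdd h'

/-- The right ring of quotients `R_F`. -/
noncomputable instance : Ring (F.Quotients R) where
  __ := (inferInstance : AddCommGroup (F.Quotients R))
  mul := act
  one := F.toQuot (1 : R)
  mul_assoc := act_assoc
  one_mul a := by
    change act _ a = a
    induction a using Quotient.inductionOn with | _ f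
    refine quot_eq f.2 fun x hx => ?_
    obtain ⟨y, hy⟩ := Submodule.mkQ_surjective _ (f.1 ⟨x, hx⟩)
    refine ⟨_, Val.pComp (y := y) ⟨hx, hy.symm⟩ (val_toQuot F 1 y), hx, ?_⟩
    rw [← hy, op_smul_eq_mul, one_mul]
  mul_one := act_one
  left_distrib := act_add
  right_distrib := add_act
  zero_mul a := by
    have h : act (0 : F.Quotients R) a = act 0 a + act 0 a := by rw [← add_act, add_zero]
    exact left_eq_add.1 h
  mul_zero a := by
    have h : act a 0 = act a 0 + act a 0 := by rw [← act_add, add_zero]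
    exact left_eq_add.1 h

theorem mul_def (a b : F.Quotients R) : a * b = act a b := rfl

theorem one_def : (1 : F.Quotients R) = F.toQuot (1 : R) := rfl

/-- `q_R` as a ring homomorphism `R → R_F`. -/
noncomputable def toQuotHom (F : GabrielFilter R) : R →+* F.Quotients R :=
  RingHom.mk' ⟨⟨F.toQuot, rfl⟩, fun r s => (act_toQuot r s).symm⟩ toQuot_add

/-- `M_F` is a right `R`-module through the right action of `R_F` and `q_R : R → R_F`. -/
noncomputable instance : Module Rᵐᵒᵖ (F.Quotients M) where
  smul c a := act a (F.toQuot (unop c))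
  one_smul a := act_one a
  mul_smul c c' a := by
    change act a (F.toQuot (unop (c * c'))) = act (act a _) _
    rw [act_assoc, ← mul_def]
    exact congrArg (act a) ((toQuotHom F).map_mul _ _)
  smul_zero c := by
    have h : act (0 : F.Quotients M) (F.toQuot (unop c)) =
        act 0 (F.toQuot (unop c)) + act 0 (F.toQuot (unop c)) := by
      rw [← add_act, add_zero]
    exact left_eq_add.1 h
  smul_add c a b := add_act a b _
  add_smul c c' a := by
    change act a (F.toQuot (unop c + unop c')) = act a _ + act a _
    rw [toQuot_add, act_add]
  zero_smul a := by
    change act a (F.toQuot 0) = 0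
    have h : act a (F.toQuot (0 : R)) = act a (F.toQuot 0) + act a (F.toQuot 0) := by
      rw [← act_add, ← toQuot_add, add_zero]
    exact left_eq_add.1 h

theorem op_smul_def (r : R) (a : F.Quotients M) : op r • a = act a (F.toQuot r) := rfl

theorem toQuot_smul (r : R) (m : M) : F.toQuot (op r • m) = op r • F.toQuot m :=
  (act_toQuot m r).symm

/-- On representatives, `(f r)(x) = f (r x)`. -/
theorem op_smul_mk_eq (r : R) (f g : F.PreQuot M)
    (h : ∀ x y, Val f.1 (r * x) y → Val g.1 x y) :
    op r • (show F.Quotients M from Quotient.mk _ f) = Quotient.mk _ g :=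
  quot_eq (F.colon_mem f.2 r) fun x hx => ⟨_, (val_toQuot F r x).pComp (val_of_mem hx),
    h x _ (val_of_mem hx)⟩

/-- The kernel of `q_M` is `t(M)`. -/
theorem toQuot_eq_zero_iff {m : M} : F.toQuot m = 0 ↔ m ∈ F.torsion M := by
  constructor
  · intro h
    obtain ⟨K, hK, h1⟩ := exists_of_rel (Quotient.exact h)
    rw [← Submodule.Quotient.mk_eq_zero]
    refine F.eq_zero_of_rightAnn_mem (F.mem_of_le hK fun x hx => ?_)
    obtain ⟨y, h2, h3⟩ := h1 x hx
    obtain rfl := h3.unique (val_zero x)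
    exact (val_toQuot F m x).unique h2
  · intro h
    refine quot_eq F.top_mem fun x _ => ⟨_, val_toQuot F m x, ?_⟩
    rw [_root_.map_smul, Submodule.mkQ_apply, (Submodule.Quotient.mk_eq_zero _).2 h, smul_zero]
    exact val_zero x

theorem torsion_mono {F G : GabrielFilter R} (h : F ≤ G) : F.torsion M ≤ G.torsion M :=
  fun _ hm => h hm

/-- The canonical map `q₁₂ : M_F → M_G` for `F ⊆ G`: compose `I → M / t_F(M)` with the projection
`M / t_F(M) → M / t_G(M)`. -/
def quotMap {F G : GabrielFilter R} (h : F ≤ G) : F.Quotients M → G.Quotients M :=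
  Quotient.map (fun f => ⟨(Submodule.factor (torsion_mono h)).compPMap f.1, h f.2⟩)
    fun f f' hf => by
      obtain ⟨K, hK, h1⟩ := exists_of_rel hf
      refine Quotient.exact (quot_eq (h hK) fun x hx => ?_)
      obtain ⟨y, ⟨h2, h3⟩, ⟨h4, h5⟩⟩ := h1 x hx
      exact ⟨Submodule.factor (torsion_mono h) y, ⟨h2, congrArg _ h3⟩, ⟨h4, congrArg _ h5⟩⟩

/-- `q₁₂ ∘ q₁ = q₂`. -/
theorem quotMap_toQuot {F G : GabrielFilter R} (h : F ≤ G) (m : M) :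
    quotMap h (F.toQuot m) = G.toQuot m := rfl

end Quotients

/-! ### Perfect filters -/

section Perfect

variable {R : Type u} [Ring R] (F : GabrielFilter R)
variable (M : Type v) [AddCommGroup M] [Module Rᵐᵒᵖ M]

/-- The relations `m r ⊗ x = m ⊗ r x` which define `M ⊗_R R_F`. -/
noncomputable def tensorRel : AddSubgroup (M ⊗[ℤ] F.Quotients R) :=
  AddSubgroup.closure {z | ∃ (m : M) (r : R) (x : F.Quotients R),
    z = (op r • m) ⊗ₜ[ℤ] x - m ⊗ₜ[ℤ] (F.toQuot r * x)}

/-- The tensor product `M ⊗_R R_F` over the noncommutative ring `R`. -/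
noncomputable abbrev TensorQuotients : Type (max u v) := (M ⊗[ℤ] F.Quotients R) ⧸ F.tensorRel M

/-- The additive map `M ⊗_ℤ R_F → M_F`, `m ⊗ x ↦ q_M(m) x`. -/
noncomputable def tensorIntMap : M ⊗[ℤ] F.Quotients R →+ F.Quotients M :=
  TensorProduct.liftAddHom
    (AddMonoidHom.mk' (fun m => AddMonoidHom.mk' (fun x => act (F.toQuot m) x)
      fun x y => act_add _ x y)
      fun m n => by
        ext x
        exact (congrArg (fun y => act y x) (toQuot_add m n)).trans (add_act _ _ x))
    (fun k m x => by
      rw [_root_.map_zsmul, _root_.map_zsmul]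
      rfl)

@[simp] theorem tensorIntMap_tmul (m : M) (x : F.Quotients R) :
    F.tensorIntMap M (m ⊗ₜ[ℤ] x) = act (F.toQuot m) x := rfl

theorem tensorRel_le_ker : F.tensorRel M ≤ (F.tensorIntMap M).ker := by
  refine (AddSubgroup.closure_le _).2 ?_
  rintro _ ⟨m, r, x, rfl⟩
  change F.tensorIntMap M _ = 0
  rw [_root_.map_sub, tensorIntMap_tmul, tensorIntMap_tmul, mul_def, ← act_assoc, act_toQuot,
    sub_self]

/-- The canonical map `M ⊗_R R_F → M_F`, `m ⊗ x ↦ q_M(m) x`. -/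
noncomputable def tensorMap : F.TensorQuotients M →+ F.Quotients M :=
  QuotientAddGroup.lift _ (F.tensorIntMap M) (F.tensorRel_le_ker M)

/-- `F` is perfect: `M ⊗_R R_F ≅ M_F` canonically, for every right `R`-module `M`. -/
def IsPerfect : Prop :=
  ∀ (M : Type u) [AddCommGroup M] [Module Rᵐᵒᵖ M], Function.Bijective (F.tensorMap M)

end Perfect

section PerfectCriterion

variable {R : Type u} [Ring R] {F G : GabrielFilter R}

theorem quotMap_add {M : Type v} [AddCommGroup M] [Module Rᵐᵒᵖ M] (h : F ≤ G)
    (x y : F.Quotients M) : quotMap h (x + y) = quotMap h x + quotMap h y := by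
  induction x using Quotient.inductionOn with | _ f
  induction y using Quotient.inductionOn with | _ g
  refine quot_eq (h (F.inf_mem f.2 g.2)) fun z hz => ⟨_, val_of_mem hz, hz, ?_⟩
  exact (_root_.map_add (Submodule.factor (torsion_mono h)) (f.1 ⟨z, hz.1⟩) (g.1 ⟨z, hz.2⟩)).symm

theorem Val.factor {M : Type v} [AddCommGroup M] [Module Rᵐᵒᵖ M] (h : F ≤ G)
    {f : R →ₗ.[Rᵐᵒᵖ] (M ⧸ F.torsion M)} {x : R} {y : M ⧸ F.torsion M} (hf : Val f x y) :
    Val ((Submodule.factor (torsion_mono h)).compPMap f) x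
      (Submodule.factor (torsion_mono h) y) := by
  obtain ⟨h1, rfl⟩ := hf
  exact ⟨h1, rfl⟩

theorem quotMap_act {M : Type v} [AddCommGroup M] [Module Rᵐᵒᵖ M] (h : F ≤ G)
    (x : F.Quotients M) (y : F.Quotients R) :
    quotMap h (act x y) = act (quotMap h x) (quotMap h y) := by
  induction x using Quotient.inductionOn with | _ f
  induction y using Quotient.inductionOn with | _ g
  refine quot_eq (h (preim_mem g.2 f.2)) fun z hz => ?_
  obtain ⟨y, hy, hz⟩ := hz
  exact ⟨_, (hz.pComp (val_of_mem hy)).factor h, (hz.factor h).pComp ((val_of_mem hy).factor h)⟩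

/-- The extension `I R_F` of a right ideal `I` of `R` to `R_F` (without assuming `I ∈ F`). -/
noncomputable def extend (F : GabrielFilter R) (I : Submodule Rᵐᵒᵖ R) :
    Submodule (F.Quotients R)ᵐᵒᵖ (F.Quotients R) :=
  Submodule.span _ (F.toQuot '' I)

theorem extend_eq_top_of_one {I : Submodule Rᵐᵒᵖ R} (h : (1 : F.Quotients R) ∈ F.extend I)
    (x : F.Quotients R) : x ∈ F.extend I := by
  have h1 := rightIdeal_mul_mem h x
  rwa [one_mul] at h1

theorem toQuot_mem_extend {I : Submodule Rᵐᵒᵖ R} {a : R} (ha : a ∈ I) :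
    F.toQuot a ∈ F.extend I := Submodule.subset_span ⟨a, ha, rfl⟩

/-- Every element of `M_F` is carried into the image of `M` by some right ideal in `F`. -/
theorem exists_act_eq_toQuot {M : Type v} [AddCommGroup M] [Module Rᵐᵒᵖ M] (x : F.Quotients M) :
    ∃ I ∈ F.sets, ∀ a ∈ I, ∃ m : M, act x (F.toQuot a) = F.toQuot m := by
  induction x using Quotient.inductionOn with | _ f
  refine ⟨_, f.2, fun a ha => ?_⟩
  obtain ⟨m, hm⟩ := Submodule.mkQ_surjective _ (f.1 ⟨a, ha⟩)
  refine ⟨m, quot_eq F.top_mem fun z _ => ⟨_, ?_, val_toQuot F m z⟩⟩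
  refine (val_toQuot F a z).pComp ?_
  rw [_root_.map_smul, hm]
  exact (val_of_mem ha).smul (op z)

theorem IsPerfect.one_mem_extend (hF : F.IsPerfect) {I : Submodule Rᵐᵒᵖ R} (hI : I ∈ F.sets) :
    (1 : F.Quotients R) ∈ F.extend I := by
  let B := F.Quotients R ⧸ F.extend I
  let p : F.Quotients R →+ B := (F.extend I).mkQ.toAddMonoidHom
  have hp : ∀ x, p x = 0 ↔ x ∈ F.extend I := fun x => Submodule.Quotient.mk_eq_zero _
  let φ : R →+ (F.Quotients R →+ B) :=
    AddMonoidHom.mk' (fun r => p.comp (AddMonoidHom.mulLeft (F.toQuot r))) fun r s => by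
      ext x
      change p (F.toQuot (r + s) * x) = p (F.toQuot r * x) + p (F.toQuot s * x)
      rw [toQuot_add, add_mul, p.map_add]
  let ψ : (R ⧸ I) →+ (F.Quotients R →+ B) :=
    QuotientAddGroup.lift I.toAddSubgroup φ fun r hr => by
      change φ r = 0
      ext x
      exact (hp _).2 (rightIdeal_mul_mem (toQuot_mem_extend hr) x)
  let θ : (R ⧸ I) ⊗[ℤ] F.Quotients R →+ B := TensorProduct.liftAddHom ψ fun k m x => by
    rw [_root_.map_zsmul, _root_.map_zsmul]
    rfl
  have hθ : ∀ (r : R) (x : F.Quotients R),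
      θ ((Submodule.Quotient.mk r : R ⧸ I) ⊗ₜ[ℤ] x) = p (F.toQuot r * x) := fun _ _ => rfl
  have hrel : F.tensorRel (R ⧸ I) ≤ θ.ker := by
    refine (AddSubgroup.closure_le _).2 ?_
    rintro _ ⟨m, r, x, rfl⟩
    obtain ⟨s, rfl⟩ := Submodule.mkQ_surjective _ m
    change θ _ = 0
    rw [← _root_.map_smul, Submodule.mkQ_apply, Submodule.mkQ_apply, _root_.map_sub, hθ, hθ,
      toQuot_smul, op_smul_def, ← mul_def, mul_assoc, sub_self]
  have hker : F.tensorIntMap (R ⧸ I) ((Submodule.Quotient.mk 1 : R ⧸ I) ⊗ₜ[ℤ] 1) = 0 := by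
    rw [tensorIntMap_tmul, one_def, act_one, toQuot_eq_zero_iff, mem_torsion]
    refine F.mem_of_le hI fun r hr => ?_
    rw [mem_rightAnn, ← Submodule.Quotient.mk_smul, Submodule.Quotient.mk_eq_zero,
      op_smul_eq_mul, one_mul]
    exact hr
  have h1 : (QuotientAddGroup.mk ((Submodule.Quotient.mk 1 : R ⧸ I) ⊗ₜ[ℤ] 1) :
      F.TensorQuotients (R ⧸ I)) = 0 := (hF (R ⧸ I)).1 (hker.trans (map_zero _).symm)
  have h2 : θ ((Submodule.Quotient.mk 1 : R ⧸ I) ⊗ₜ[ℤ] 1) = 0 :=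
    hrel ((QuotientAddGroup.eq_zero_iff _).1 h1)
  rw [hθ, mul_one, hp] at h2
  exact h2

theorem isPerfect_of_one_mem_extend
    (h : ∀ I ∈ F.sets, (1 : F.Quotients R) ∈ F.extend I) : F.IsPerfect := by
  intro M _ _
  -- right multiplication by `z` on `M ⊗_R R_F`
  let ρ : F.Quotients R → (M ⊗[ℤ] F.Quotients R →+ M ⊗[ℤ] F.Quotients R) := fun z =>
    (TensorProduct.map LinearMap.id (AddMonoidHom.mulRight z).toIntLinearMap).toAddMonoidHom
  have hρ : ∀ z m x, ρ z (m ⊗ₜ[ℤ] x) = m ⊗ₜ[ℤ] (x * z) := fun _ _ _ => rfl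
  have hρadd : ∀ z z' t, ρ (z + z') t = ρ z t + ρ z' t := fun z z' t => by
    induction t with
    | zero => simp
    | tmul m x => rw [hρ, hρ, hρ, mul_add, TensorProduct.tmul_add]
    | add a b ha hb => rw [_root_.map_add, _root_.map_add, _root_.map_add, ha, hb]; abel
  have hρmul : ∀ z z' t, ρ (z * z') t = ρ z' (ρ z t) := fun z z' t => by
    induction t with
    | zero => simp
    | tmul m x => rw [hρ, hρ, hρ, mul_assoc]
    | add a b ha hb => rw [_root_.map_add, _root_.map_add, _root_.map_add, ha, hb]
  have hρone : ∀ t, ρ 1 t = t := fun t => by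
    induction t with
    | zero => simp
    | tmul m x => rw [hρ, mul_one]
    | add a b ha hb => rw [_root_.map_add, ha, hb]
  have hρzero : ∀ t, ρ 0 t = 0 := fun t => by
    have h1 := hρadd 0 0 t
    rw [add_zero] at h1
    exact left_eq_add.1 h1
  have hgen : ∀ (m : M) (r : R) (x : F.Quotients R),
      (op r • m) ⊗ₜ[ℤ] x - m ⊗ₜ[ℤ] (F.toQuot r * x) ∈ F.tensorRel M :=
    fun m r x => AddSubgroup.subset_closure ⟨m, r, x, rfl⟩
  have hρrel : ∀ z, ∀ t ∈ F.tensorRel M, ρ z t ∈ F.tensorRel M := fun z t ht => by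
    refine (AddSubgroup.closure_le ((F.tensorRel M).comap (ρ z))).2 ?_ ht
    rintro _ ⟨m, r, x, rfl⟩
    change ρ z _ ∈ F.tensorRel M
    rw [_root_.map_sub, hρ, hρ, mul_assoc]
    exact hgen _ _ _
  -- an element which is annihilated by a right ideal in `F` is zero
  have hzero : ∀ t, ∀ I ∈ F.sets, (∀ a ∈ I, ρ (F.toQuot a) t ∈ F.tensorRel M) →
      t ∈ F.tensorRel M := fun t I hI ht => by
    have h1 : ∀ z ∈ F.extend I, ρ z t ∈ F.tensorRel M := fun z hz => by
      induction hz using Submodule.span_induction with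
      | mem z hz => obtain ⟨a, ha, rfl⟩ := hz; exact ht a ha
      | zero => rw [hρzero]; exact zero_mem _
      | add z z' _ _ hz hz' => rw [hρadd]; exact add_mem hz hz'
      | smul c z _ hz =>
        rw [show c • z = z * unop c from rfl, hρmul]
        exact hρrel _ _ hz
    have h2 := h1 1 (h I hI)
    rwa [hρone] at h2
  have hloc : ∀ t, ∃ I ∈ F.sets, ∀ a ∈ I, ∃ n : M,
      ρ (F.toQuot a) t - n ⊗ₜ[ℤ] 1 ∈ F.tensorRel M := fun t => by
    induction t with
    | zero => exact ⟨⊤, F.top_mem, fun a _ => ⟨0, by simp [zero_mem]⟩⟩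
    | tmul m x =>
      obtain ⟨I, hI, h1⟩ := exists_act_eq_toQuot x
      refine ⟨I, hI, fun a ha => ?_⟩
      obtain ⟨r, hr⟩ := h1 a ha
      refine ⟨op r • m, ?_⟩
      have h2 := neg_mem (hgen m r 1)
      rw [neg_sub, mul_one, ← hr] at h2
      exact h2
    | add s t hs ht =>
      obtain ⟨I, hI, h1⟩ := hs
      obtain ⟨J, hJ, h2⟩ := ht
      refine ⟨_, F.inf_mem hI hJ, fun a ha => ?_⟩
      obtain ⟨n, hn⟩ := h1 a ha.1
      obtain ⟨n', hn'⟩ := h2 a ha.2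
      refine ⟨n + n', ?_⟩
      rw [_root_.map_add, TensorProduct.add_tmul, add_sub_add_comm]
      exact add_mem hn hn'
  have hmap : ∀ z t, F.tensorIntMap M (ρ z t) = act (F.tensorIntMap M t) z := fun z t => by
    induction t with
    | zero =>
      have h1 : act (0 : F.Quotients M) z = act 0 z + act 0 z := by rw [← add_act, add_zero]
      rw [_root_.map_zero, _root_.map_zero, left_eq_add.1 h1]
    | tmul m x => rw [hρ, tensorIntMap_tmul, tensorIntMap_tmul, mul_def, act_assoc]
    | add s t hs ht => rw [_root_.map_add, _root_.map_add, _root_.map_add, add_act, hs, ht]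
  have hz0 : ∀ z, act (0 : F.Quotients M) z = 0 := fun z => by
    have h1 := hmap z 0
    rw [_root_.map_zero, _root_.map_zero] at h1
    exact h1.symm
  constructor
  · refine (injective_iff_map_eq_zero _).2 fun y hy => ?_
    obtain ⟨t, rfl⟩ := QuotientAddGroup.mk_surjective y
    have hy' : F.tensorIntMap M t = 0 := hy
    obtain ⟨I, hI, h1⟩ := hloc t
    refine (QuotientAddGroup.eq_zero_iff t).2 (hzero t I hI fun a ha => ?_)
    obtain ⟨n, hn⟩ := h1 a ha
    have h2 := F.tensorRel_le_ker M hn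
    rw [AddMonoidHom.mem_ker, _root_.map_sub, hmap, hy', hz0, tensorIntMap_tmul, one_def, act_one,
      zero_sub, neg_eq_zero, toQuot_eq_zero_iff, mem_torsion] at h2
    have h3 : n ⊗ₜ[ℤ] (1 : F.Quotients R) ∈ F.tensorRel M := hzero _ _ h2 fun b hb => by
      have h4 := neg_mem (hgen n b 1)
      have h5 : op b • n = 0 := hb
      rw [neg_sub, mul_one, h5, TensorProduct.zero_tmul, sub_zero] at h4
      rw [hρ, one_mul]
      exact h4
    have h6 := add_mem hn h3
    rwa [sub_add_cancel] at h6
  · intro x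
    obtain ⟨I, hI, h1⟩ := exists_act_eq_toQuot x
    have h2 : ∀ z ∈ F.extend I, act x z ∈ (F.tensorMap M).range := fun z hz => by
      induction hz using Submodule.span_induction with
      | mem z hz =>
        obtain ⟨a, ha, rfl⟩ := hz
        obtain ⟨m, hm⟩ := h1 a ha
        refine ⟨QuotientAddGroup.mk (m ⊗ₜ[ℤ] 1), ?_⟩
        rw [hm]
        exact act_one (F.toQuot m)
      | zero =>
        have h3 : act x (0 : F.Quotients R) = act x 0 + act x 0 := by rw [← act_add, add_zero]
        rw [left_eq_add.1 h3]
        exact zero_mem _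
      | add z z' _ _ hz hz' => rw [act_add]; exact add_mem hz hz'
      | smul c z _ hz =>
        obtain ⟨y, hy⟩ := hz
        obtain ⟨t, rfl⟩ := QuotientAddGroup.mk_surjective y
        refine ⟨QuotientAddGroup.mk (ρ (unop c) t), ?_⟩
        change F.tensorIntMap M t = act x z at hy
        change F.tensorIntMap M (ρ (unop c) t) = act x (z * unop c)
        rw [hmap, hy, mul_def, act_assoc]
    have h3 := h2 1 (h I hI)
    rw [one_def, act_one] at h3
    exact h3

theorem toQuot_mul (G : GabrielFilter R) (r s : R) :
    G.toQuot r * G.toQuot s = G.toQuot (r * s) := act_toQuot r s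

theorem toQuot_mul_mem_extend {I J : Submodule Rᵐᵒᵖ R} {r : R} (h : ∀ s ∈ I, r * s ∈ J)
    {z : G.Quotients R} (hz : z ∈ G.extend I) : G.toQuot r * z ∈ G.extend J := by
  induction hz using Submodule.span_induction with
  | mem z hz =>
    obtain ⟨s, hs, rfl⟩ := hz
    rw [toQuot_mul]
    exact toQuot_mem_extend (h s hs)
  | zero => rw [mul_zero]; exact zero_mem _
  | add z z' _ _ hz hz' => rw [mul_add]; exact add_mem hz hz'
  | smul c z _ hz =>
    rw [show c • z = z * unop c from rfl, ← mul_assoc]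
    exact rightIdeal_mul_mem hz _

theorem one_mem_extend_of_forall {I J : Submodule Rᵐᵒᵖ R} (hI : (1 : G.Quotients R) ∈ G.extend I)
    (h : ∀ r ∈ I, G.toQuot r ∈ G.extend J) : (1 : G.Quotients R) ∈ G.extend J :=
  (Submodule.span_le (p := G.extend J)).2 (by rintro _ ⟨r, hr, rfl⟩; exact h r hr) hI

/-- The right ideals `I` such that `(I : a) R_G = R_G` for all `a ∈ R`. -/
noncomputable def extendFilter (G : GabrielFilter R) : GabrielFilter R where
  sets := {I | ∀ a, (1 : G.Quotients R) ∈ G.extend (rightColon I a)}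
  top_mem _ := toQuot_mem_extend (F := G) trivial
  mem_of_le h hle a :=
    one_mem_extend_of_forall (h a) fun r hr => toQuot_mem_extend (F := G) (hle hr)
  inf_mem {I J} hI hJ a := one_mem_extend_of_forall (hI a) fun r hr => by
    rw [← mul_one (G.toQuot r)]
    refine toQuot_mul_mem_extend (J := rightColon (I ⊓ J) a) (fun s hs => ⟨?_, ?_⟩) (hJ (a * r))
    · exact rightIdeal_mul_mem (I := rightColon I a) hr s
    · change a * (r * s) ∈ J
      rw [← mul_assoc]; exact hs
  colon_mem {I} h c a := by
    have h1 : rightColon (rightColon I c) a = rightColon I (c * a) := by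
      ext r; simp [mul_assoc]
    rw [h1]
    exact h (c * a)
  mem_of_colon {I J} hI hJ a := one_mem_extend_of_forall (hI a) fun r hr => by
    rw [← mul_one (G.toQuot r)]
    refine toQuot_mul_mem_extend (J := rightColon J a) (fun s hs => ?_) (hJ (a * r) hr 1)
    have hs' : a * r * (1 * s) ∈ J := hs
    rw [one_mul, mul_assoc] at hs'
    exact hs'

theorem IsPerfect.le_extendFilter (hF : F.IsPerfect) (h : F ≤ G) : F ≤ G.extendFilter := by
  intro I hI a
  have h1 : ∀ z ∈ F.extend (rightColon I a), quotMap h z ∈ G.extend (rightColon I a) :=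
    fun z hz => by
      induction hz using Submodule.span_induction with
      | mem z hz => obtain ⟨r, hr, rfl⟩ := hz; exact toQuot_mem_extend hr
      | zero =>
        have h2 := quotMap_add h (0 : F.Quotients R) 0
        rw [add_zero] at h2
        rw [left_eq_add.1 h2]
        exact zero_mem _
      | add z z' _ _ hz hz' => rw [quotMap_add]; exact add_mem hz hz'
      | smul c z _ hz =>
        rw [show c • z = act z (unop c) from rfl, quotMap_act]
        exact rightIdeal_mul_mem hz _
  exact h1 1 (hF.one_mem_extend (F.colon_mem hI a))

/-- A join of perfect filters is perfect. -/
theorem isPerfect_join {S : Set (GabrielFilter R)} (hS : ∀ F ∈ S, F.IsPerfect) :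
    (join S).IsPerfect := by
  refine isPerfect_of_one_mem_extend fun I hI => ?_
  have h1 : join S ≤ (join S).extendFilter :=
    (isLUB_join S).2 fun F hF => (hS F hF).le_extendFilter ((isLUB_join S).1 hF)
  have h2 := h1 hI 1
  have h3 : rightColon I 1 = I := by ext r; simp
  rwa [h3] at h2

end PerfectCriterion

/-! ### The Lambek, Goldie, classical and maximal perfect torsion theories -/

section Examples

variable (R : Type u) [Ring R]

variable {R} in
/-- Dense right ideals. -/
def IsDenseIdeal (I : Submodule Rᵐᵒᵖ R) : Prop :=
  ∀ a b : R, b ≠ 0 → ∃ r : R, a * r ∈ I ∧ b * r ≠ 0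

/-- The filter of the Lambek torsion theory: all dense right ideals. Its right ring of quotients
is the maximal right ring of quotients. -/
def lambek : GabrielFilter R where
  sets := {I | IsDenseIdeal I}
  top_mem _ b hb := ⟨1, trivial, by rwa [mul_one]⟩
  mem_of_le h hle a b hb := by
    obtain ⟨r, h1, h2⟩ := h a b hb
    exact ⟨r, hle h1, h2⟩
  inf_mem {I J} h h' a b hb := by
    obtain ⟨r, h1, h2⟩ := h a b hb
    obtain ⟨s, h3, h4⟩ := h' (a * r) (b * r) h2
    refine ⟨r * s, ⟨?_, ?_⟩, ?_⟩
    · rw [← mul_assoc]; exact rightIdeal_mul_mem h1 s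
    · rw [← mul_assoc]; exact h3
    · rw [← mul_assoc]; exact h4
  colon_mem {I} h c a b hb := by
    obtain ⟨r, h1, h2⟩ := h (c * a) b hb
    exact ⟨r, by rw [mem_rightColon, ← mul_assoc]; exact h1, h2⟩
  mem_of_colon {I J} h h' a b hb := by
    obtain ⟨r, h1, h2⟩ := h a b hb
    obtain ⟨s, h3, h4⟩ := h' (a * r) h1 1 (b * r) h2
    rw [mem_rightColon, one_mul] at h3
    exact ⟨r * s, by rw [← mul_assoc]; exact h3, by rw [← mul_assoc]; exact h4⟩

/-- The Lambek torsion theory is the largest faithful hereditary torsion theory. -/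
theorem isGreatest_lambek : IsGreatest {F : GabrielFilter R | F.IsFaithful} (lambek R) := by
  constructor
  · refine (Submodule.eq_bot_iff _).2 fun b hb => ?_
    by_contra hne
    obtain ⟨r, h1, h2⟩ := (mem_torsion.1 hb) 1 b hne
    rw [one_mul] at h1
    exact h2 h1
  · intro F hF I hI a b hb
    by_contra! hcon
    refine hb ((Submodule.eq_bot_iff _).1 hF b (mem_torsion.2 (F.mem_of_le (F.colon_mem hI a) ?_)))
    intro r hr
    exact hcon r hr

variable {R} in
/-- Essential right ideals. -/
def IsEssentialIdeal (I : Submodule Rᵐᵒᵖ R) : Prop :=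
  ∀ J : Submodule Rᵐᵒᵖ R, J ≠ ⊥ → I ⊓ J ≠ ⊥

/-- A right module is nonsingular if no nonzero element has an essential right annihilator. -/
def IsNonsingularModule (N : Type v) [AddCommGroup N] [Module Rᵐᵒᵖ N] : Prop :=
  ∀ x : N, IsEssentialIdeal (rightAnn x : Submodule Rᵐᵒᵖ R) → x = 0

/-- The filter of the Goldie torsion theory: the smallest Gabriel filter which contains all
essential right ideals. -/
def goldie : GabrielFilter R :=
  inter {F | ∀ I : Submodule Rᵐᵒᵖ R, IsEssentialIdeal I → I ∈ F.sets}

variable {R} in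
theorem IsEssentialIdeal.colon {I : Submodule Rᵐᵒᵖ R} (h : IsEssentialIdeal I) (a : R) :
    IsEssentialIdeal (rightColon I a) := by
  intro J hJ
  by_cases h0 : J.map (leftMulMap a) = ⊥
  · have hle : J ≤ rightColon I a := fun r hr => by
      have h1 : leftMulMap a r = 0 := (Submodule.eq_bot_iff _).1 h0 _ ⟨r, hr, rfl⟩
      change leftMulMap a r ∈ I
      rw [h1]; exact I.zero_mem
    rwa [inf_eq_right.2 hle]
  · obtain ⟨y, ⟨hyI, r, hr, rfl⟩, hy0⟩ := (Submodule.ne_bot_iff _).1 (h _ h0)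
    refine (Submodule.ne_bot_iff _).2 ⟨r, ⟨hyI, hr⟩, ?_⟩
    rintro rfl
    exact hy0 (map_zero _)

/-- The Gabriel filter `{I | x (I : a) = 0 implies x = 0, for all a ∈ R and x ∈ N}`, for which `N`
is torsion-free. -/
def cogenerated (N : Type v) [AddCommGroup N] [Module Rᵐᵒᵖ N] : GabrielFilter R where
  sets := {I | ∀ (a : R) (x : N), (∀ r, a * r ∈ I → op r • x = 0) → x = 0}
  top_mem a x h := by simpa using h 1 trivial
  mem_of_le h hle a x hx := h a x fun r hr => hx r (hle hr)
  inf_mem {I J} h h' a x hx := h a x fun r hr => h' (a * r) (op r • x) fun s hs => by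
    rw [← mul_smul, ← op_mul]
    refine hx _ ⟨?_, ?_⟩
    · rw [← mul_assoc]; exact rightIdeal_mul_mem hr s
    · rw [← mul_assoc]; exact hs
  colon_mem {I} h c a x hx := h (c * a) x fun r hr => hx r (by
    rw [mem_rightColon, ← mul_assoc]; exact hr)
  mem_of_colon {I J} h h' a x hx := h a x fun r hr => h' (a * r) hr 1 (op r • x) fun s hs => by
    rw [mem_rightColon, one_mul] at hs
    rw [← mul_smul, ← op_mul]
    exact hx _ (by rw [← mul_assoc]; exact hs)

/-- The torsion-free modules of the Goldie torsion theory are the nonsingular modules. -/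
theorem goldie_torsion_eq_bot_iff (N : Type v) [AddCommGroup N] [Module Rᵐᵒᵖ N] :
    (goldie R).torsion N = ⊥ ↔ IsNonsingularModule R N := by
  constructor
  · intro h x hx
    exact (Submodule.eq_bot_iff _).1 h x (mem_torsion.2 fun F hF => hF _ hx)
  · intro h
    refine (Submodule.eq_bot_iff _).2 fun x hx => ?_
    have h1 : rightAnn x ∈ (cogenerated R N).sets := hx _ fun I hI a y hy =>
      h y fun J hJ hbot => (hI.colon a) J hJ
        ((Submodule.eq_bot_iff _).2 fun r hr =>
          (Submodule.eq_bot_iff _).1 hbot r ⟨hy r hr.1, hr.2⟩)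
    exact h1 1 x fun r hr => by
      rw [one_mul] at hr
      exact hr

/-- `R` is a right Ore ring: `r T ∩ t R` is nonempty for all `r ∈ R` and `t ∈ T`, where `T` is
the set of regular elements. -/
def IsRightOre : Prop :=
  ∀ r : R, ∀ t ∈ nonZeroDivisors R, ∃ t' ∈ nonZeroDivisors R, ∃ r' : R, r * t' = t * r'

/-- The filter of the classical torsion theory: the right ideals `I` such that every element of
`R / I` is annihilated by a regular element. -/
def classical : GabrielFilter R where
  sets := {I | ∀ a : R, ∃ t ∈ nonZeroDivisors R, a * t ∈ I}
  top_mem _ := ⟨1, one_mem _, trivial⟩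
  mem_of_le h hle a := by
    obtain ⟨t, ht, h1⟩ := h a
    exact ⟨t, ht, hle h1⟩
  inf_mem {I J} h h' a := by
    obtain ⟨t, ht, h1⟩ := h a
    obtain ⟨s, hs, h2⟩ := h' (a * t)
    refine ⟨t * s, mul_mem ht hs, ?_, ?_⟩
    · rw [← mul_assoc]; exact rightIdeal_mul_mem h1 s
    · rw [← mul_assoc]; exact h2
  colon_mem {I} h c a := by
    obtain ⟨t, ht, h1⟩ := h (c * a)
    exact ⟨t, ht, by rw [mem_rightColon, ← mul_assoc]; exact h1⟩
  mem_of_colon {I J} h h' a := by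
    obtain ⟨t, ht, h1⟩ := h a
    obtain ⟨s, hs, h2⟩ := h' (a * t) h1 1
    rw [mem_rightColon, one_mul] at h2
    exact ⟨t * s, mul_mem ht hs, by rw [← mul_assoc]; exact h2⟩

/-- For a right Ore ring, an element of a right module is torsion for the classical torsion theory
iff it is annihilated by a regular element. -/
theorem mem_classical_torsion_iff (h : IsRightOre R) {M : Type v} [AddCommGroup M]
    [Module Rᵐᵒᵖ M] {m : M} :
    m ∈ (classical R).torsion M ↔ ∃ t ∈ nonZeroDivisors R, op t • m = 0 := by
  constructor
  · intro hm
    obtain ⟨t, ht, h1⟩ := (mem_torsion.1 hm) 1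
    rw [one_mul] at h1
    exact ⟨t, ht, h1⟩
  · rintro ⟨t, ht, h1⟩ a
    obtain ⟨t', ht', r', h2⟩ := h a t ht
    refine ⟨t', ht', ?_⟩
    rw [h2, mem_rightAnn, op_mul, mul_smul, h1, smul_zero]

/-- The filter of the maximal perfect torsion theory: the join of all faithful perfect filters.
Its right ring of quotients is the total right ring of quotients. -/
def total : GabrielFilter R := join {F | F.IsFaithful ∧ F.IsPerfect}

/-- The join in the definition of `total` is itself faithful and perfect: it is the largest
faithful perfect filter. -/
theorem isGreatest_total :
    IsGreatest {F : GabrielFilter R | F.IsFaithful ∧ F.IsPerfect} (total R) := by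
  refine ⟨⟨?_, isPerfect_join fun F hF => hF.2⟩, (isLUB_join _).1⟩
  have h1 : total R ≤ lambek R := (isLUB_join _).2 fun F hF => (isGreatest_lambek R).2 hF.1
  exact eq_bot_iff.2 ((torsion_mono h1).trans (isGreatest_lambek R).1.le)

end Examples

/-! ### Extensions of derivations -/

section Extensions

variable {R : Type u} [Ring R]

/-- `D` is a derivation of the ring `R_F` which extends the derivation `δ` of `R`:
`D ∘ q_R = q_R ∘ δ`. -/
structure IsRingExtension (F : GabrielFilter R) (δ : R → R) (D : F.Quotients R → F.Quotients R) :
    Prop where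
  isRingDerivation : IsRingDerivation D
  apply_toQuot : ∀ r, D (F.toQuot r) = F.toQuot (δ r)

/-- `D` is a `δ`-derivation of `M_F` which extends the `δ`-derivation `d` of `M`:
`D ∘ q_M = q_M ∘ d`. -/
structure IsModuleExtension (F : GabrielFilter R) (δ : R → R) {M : Type v} [AddCommGroup M]
    [Module Rᵐᵒᵖ M] (d : M → M) (D : F.Quotients M → F.Quotients M) : Prop where
  isModuleDerivation : IsModuleDerivation δ D
  apply_toQuot : ∀ m, D (F.toQuot m) = F.toQuot (d m)

/-- `F ⊆ G`, the derivation `δ` of `R` extends uniquely to `R_F` and to `R_G`, and the two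
extensions `D₁` and `D₂` agree: `q₁₂ ∘ D₁ = D₂ ∘ q₁₂`. -/
def RingExtensionsAgree (F G : GabrielFilter R) (δ : R → R) : Prop :=
  ∃ (h : F ≤ G) (D₁ : F.Quotients R → F.Quotients R) (D₂ : G.Quotients R → G.Quotients R),
    (F.IsRingExtension δ D₁ ∧ ∀ D, F.IsRingExtension δ D → D = D₁) ∧
    (G.IsRingExtension δ D₂ ∧ ∀ D, G.IsRingExtension δ D → D = D₂) ∧
    ∀ x, quotMap h (D₁ x) = D₂ (quotMap h x)

/-- `F ⊆ G`, the `δ`-derivation `d` of `M` extends uniquely to `M_F` and to `M_G`, and the two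
extensions `D₁` and `D₂` agree: `q₁₂ ∘ D₁ = D₂ ∘ q₁₂`. -/
def ModuleExtensionsAgree (F G : GabrielFilter R) (δ : R → R) {M : Type v} [AddCommGroup M]
    [Module Rᵐᵒᵖ M] (d : M → M) : Prop :=
  ∃ (h : F ≤ G) (D₁ : F.Quotients M → F.Quotients M) (D₂ : G.Quotients M → G.Quotients M),
    (F.IsModuleExtension δ d D₁ ∧ ∀ D, F.IsModuleExtension δ d D → D = D₁) ∧
    (G.IsModuleExtension δ d D₂ ∧ ∀ D, G.IsModuleExtension δ d D → D = D₂) ∧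
    ∀ x, quotMap h (D₁ x) = D₂ (quotMap h x)

end Extensions

end GabrielFilter

namespace GabrielFilter

/-! ### Derivations, Gabriel filters and torsion -/

section DerivationsOfQuotients

variable {R : Type u} [Ring R]

/-! Everything reduces to one statement: for any two Gabriel filters `F ≤ G`, the derivation extends
uniquely to both modules of quotients and the canonical map intertwines the extensions
(`moduleExtensionsAgree`, `ringExtensionsAgree`). What then remains is to compare filters.

Existence rests on the fact that every Gabriel filter is differential (`derivIdeal_mem`). Hence `d`
preserves torsion, descends to `M / t(M)`, and acts on a homomorphism `f : I → M / t(M)` as a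
commutator, `r ↦ d (f r) - f (δ r)`, on the `r ∈ I` with `δ r ∈ I`, which form a right ideal in `F`.
This respects equality in the direct limit and satisfies the Leibniz rule for the action of `R_F`
(`extendDeriv_act`), so the same formula gives a derivation of the ring when `M = R`.

Uniqueness and compatibility share one argument (`eq_of_eq_on_toQuot`). An element `x` of `M_F` is
carried into the image of `M` by some `I ∈ F`, and the Leibniz rule on `x a`, for `a ∈ I`,
determines the value at `x` up to an element killed by `I`. Such an element is zero, since modules
of quotients are torsion-free.

The inclusions of filters are: faithful filters lie in the Lambek filter, dense right ideals are
essential, and for a right Ore ring the classical filter is faithful and perfect, hence contained in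
`total R`. -/

theorem _root_.IsRingDerivation.isModuleDerivation {δ : R → R} (hδ : IsRingDerivation δ) :
    IsModuleDerivation δ δ where
  map_add := hδ.map_add
  map_smul x r := hδ.map_mul x r

theorem _root_.IsModuleDerivation.map_zero {M : Type v} [AddCommGroup M] [Module Rᵐᵒᵖ M]
    {δ : R → R} {d : M → M} (hd : IsModuleDerivation δ d) : d 0 = 0 := by
  have h := hd.map_add 0 0
  rw [add_zero] at h
  exact left_eq_add.1 h

/-- The right ideal `{r ∈ I | δ r ∈ I}`. -/
def derivIdeal {δ : R → R} (hδ : IsRingDerivation δ) (I : Submodule Rᵐᵒᵖ R) :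
    Submodule Rᵐᵒᵖ R where
  carrier := {r | r ∈ I ∧ δ r ∈ I}
  zero_mem' := ⟨I.zero_mem, by rw [hδ.isModuleDerivation.map_zero]; exact I.zero_mem⟩
  add_mem' {a b} ha hb := ⟨I.add_mem ha.1 hb.1, by
    rw [hδ.map_add]; exact I.add_mem ha.2 hb.2⟩
  smul_mem' c r hr := ⟨I.smul_mem c hr.1, by
    rw [smul_eq_mul_unop, hδ.map_mul]
    exact I.add_mem (rightIdeal_mul_mem hr.2 _) (rightIdeal_mul_mem hr.1 _)⟩

/-- On `I`, the map `r ↦ δ r + I` is linear with kernel `derivIdeal hδ I`.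
Hence every Gabriel filter is differential. -/
theorem derivIdeal_mem (F : GabrielFilter R) {δ : R → R} (hδ : IsRingDerivation δ)
    {I : Submodule Rᵐᵒᵖ R} (hI : I ∈ F.sets) : derivIdeal hδ I ∈ F.sets := by
  -- For `a ∈ I`, the rule `δ (a s) = δ a * s + a * δ s` has its last term in `I`, so `(I : δ a)`
  -- lies in the colon ideal of `derivIdeal hδ I` at `a`.
  refine F.mem_of_colon hI fun a ha => F.mem_of_le (F.colon_mem hI (δ a)) fun s hs => ?_
  refine ⟨rightIdeal_mul_mem ha s, ?_⟩
  change δ (a * s) ∈ I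
  rw [hδ.map_mul]
  exact I.add_mem hs (rightIdeal_mul_mem ha _)

variable {M : Type v} [AddCommGroup M] [Module Rᵐᵒᵖ M] {F G : GabrielFilter R}
  {δ : R → R} {d : M → M}

/-- If both `r` and `δ r` annihilate `m`, the Leibniz rule for `d (m r) = 0` leaves `d m * r = 0`.
By `derivIdeal_mem` such `r` form a right ideal in `F`. -/
theorem deriv_mem_torsion (F : GabrielFilter R) (hδ : IsRingDerivation δ)
    (hd : IsModuleDerivation δ d) {m : M} (hm : m ∈ F.torsion M) : d m ∈ F.torsion M := by
  refine F.mem_of_le (F.derivIdeal_mem hδ hm) fun r hr => ?_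
  have h1 : op r • m = 0 := hr.1
  have h2 : op (δ r) • m = 0 := hr.2
  have h3 := hd.map_smul m r
  rw [h1, h2, hd.map_zero, add_zero] at h3
  exact h3.symm

/-- The derivation of `M / t(M)` which is induced by a derivation of `M`. -/
def torsionFreeDeriv (F : GabrielFilter R) (hδ : IsRingDerivation δ)
    (hd : IsModuleDerivation δ d) : M ⧸ F.torsion M →+ M ⧸ F.torsion M :=
  QuotientAddGroup.map (F.torsion M).toAddSubgroup (F.torsion M).toAddSubgroup
    (AddMonoidHom.mk' d hd.map_add) fun _ hm => F.deriv_mem_torsion hδ hd hm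

theorem torsionFreeDeriv_mkQ (hδ : IsRingDerivation δ) (hd : IsModuleDerivation δ d) (m : M) :
    F.torsionFreeDeriv hδ hd ((F.torsion M).mkQ m) = (F.torsion M).mkQ (d m) := rfl

theorem torsionFreeDeriv_smul (hδ : IsRingDerivation δ) (hd : IsModuleDerivation δ d)
    (y : M ⧸ F.torsion M) (r : R) :
    F.torsionFreeDeriv hδ hd (op r • y) = op r • F.torsionFreeDeriv hδ hd y + op (δ r) • y := by
  obtain ⟨m, rfl⟩ := Submodule.mkQ_surjective _ y
  rw [← _root_.map_smul, torsionFreeDeriv_mkQ, hd.map_smul, _root_.map_add, _root_.map_smul,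
    _root_.map_smul, torsionFreeDeriv_mkQ]

/-! ### Construction of the extension -/

/-- The homomorphism `r ↦ d (f r) - f (δ r)`. -/
def pDeriv (hδ : IsRingDerivation δ) (hd : IsModuleDerivation δ d)
    (f : R →ₗ.[Rᵐᵒᵖ] (M ⧸ F.torsion M)) : R →ₗ.[Rᵐᵒᵖ] (M ⧸ F.torsion M) where
  domain := derivIdeal hδ f.domain
  toFun :=
    { toFun := fun r => F.torsionFreeDeriv hδ hd (f ⟨r, r.2.1⟩) - f ⟨δ r, r.2.2⟩
      map_add' := fun r s => by
        have h1 : f ⟨(r + s : derivIdeal hδ f.domain), (r + s).2.1⟩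
            = f ⟨r, r.2.1⟩ + f ⟨s, s.2.1⟩ := f.map_add ⟨r, r.2.1⟩ ⟨s, s.2.1⟩
        have h2 : f ⟨δ (r + s : derivIdeal hδ f.domain), (r + s).2.2⟩
            = f ⟨δ r, r.2.2⟩ + f ⟨δ s, s.2.2⟩ :=
          Val.unique (val_of_mem _) (by
            rw [Submodule.coe_add, hδ.map_add]
            exact (val_of_mem r.2.2).add (val_of_mem s.2.2))
        rw [h1, h2, _root_.map_add]
        abel
      map_smul' := fun c r => by
        obtain ⟨c, rfl⟩ := op_surjective c
        have h1 : f ⟨(op c • r : derivIdeal hδ f.domain), (op c • r).2.1⟩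
            = op c • f ⟨r, r.2.1⟩ := f.map_smul (op c) ⟨r, r.2.1⟩
        have h2 : f ⟨δ (op c • r : derivIdeal hδ f.domain), (op c • r).2.2⟩
            = op c • f ⟨δ r, r.2.2⟩ + op (δ c) • f ⟨r, r.2.1⟩ :=
          Val.unique (val_of_mem _) (by
            rw [Submodule.coe_smul, op_smul_eq_mul, hδ.map_mul]
            exact ((val_of_mem r.2.2).smul (op c)).add ((val_of_mem r.2.1).smul (op (δ c))))
        -- The term `f r * δ c` arises once from the derivation of `M / t(M)` and once from `f (δ (r
        -- c))`. It cancels in the difference, which is what makes the commutator linear.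
        rw [h1, h2, torsionFreeDeriv_smul, RingHom.id_apply, smul_sub]
        abel }

theorem Val.pDeriv (hδ : IsRingDerivation δ) (hd : IsModuleDerivation δ d)
    {f : R →ₗ.[Rᵐᵒᵖ] (M ⧸ F.torsion M)} {r : R} {y z : M ⧸ F.torsion M}
    (hy : Val f r y) (hz : Val f (δ r) z) :
    Val (pDeriv hδ hd f) r (F.torsionFreeDeriv hδ hd y - z) := by
  obtain ⟨h1, rfl⟩ := hy
  obtain ⟨h2, rfl⟩ := hz
  exact ⟨⟨h1, h2⟩, rfl⟩

/-- The derivation of `M_F` which extends `d`. -/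
def extendDeriv (F : GabrielFilter R) (hδ : IsRingDerivation δ) (hd : IsModuleDerivation δ d) :
    F.Quotients M → F.Quotients M :=
  Quotient.map (fun f => ⟨pDeriv hδ hd f.1, F.derivIdeal_mem hδ f.2⟩) fun f g h => by
    -- The values at `x` involve `f` and `g` at both `x` and `δ x`, so the equalizer of `f` and `g`
    -- must be shrunk to its `derivIdeal`.
    refine Quotient.exact (quot_eq (F.derivIdeal_mem hδ h) fun x hx => ?_)
    obtain ⟨⟨h1, h2, h3⟩, ⟨h4, h5, h6⟩⟩ := hx
    exact ⟨_, Val.pDeriv hδ hd ⟨h1, rfl⟩ ⟨h4, rfl⟩, Val.pDeriv hδ hd ⟨h2, h3.symm⟩ ⟨h5, h6.symm⟩⟩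

theorem extendDeriv_toQuot (hδ : IsRingDerivation δ) (hd : IsModuleDerivation δ d) (m : M) :
    F.extendDeriv hδ hd (F.toQuot m) = F.toQuot (d m) :=
  quot_eq F.top_mem fun x _ =>
    ⟨_, Val.pDeriv hδ hd (val_toQuot F m x) (val_toQuot F m (δ x)), by
      -- This is `d (m x) - m δ(x) = d(m) x`.
      rw [torsionFreeDeriv_mkQ, hd.map_smul, _root_.map_add, add_sub_cancel_right]
      exact val_toQuot F (d m) x⟩

theorem extendDeriv_add (hδ : IsRingDerivation δ) (hd : IsModuleDerivation δ d)
    (x y : F.Quotients M) :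
    F.extendDeriv hδ hd (x + y) = F.extendDeriv hδ hd x + F.extendDeriv hδ hd y := by
  induction x using Quotient.inductionOn with | _ f
  induction y using Quotient.inductionOn with | _ g
  refine quot_eq (F.derivIdeal_mem hδ (F.inf_mem f.2 g.2)) fun r hr => ?_
  obtain ⟨⟨h1, h2⟩, ⟨h3, h4⟩⟩ := hr
  refine ⟨_, Val.pDeriv hδ hd ((val_of_mem h1).pAdd (val_of_mem h2))
    ((val_of_mem h3).pAdd (val_of_mem h4)), ?_⟩
  rw [_root_.map_add, add_sub_add_comm]
  exact (Val.pDeriv hδ hd (val_of_mem h1) (val_of_mem h3)).pAdd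
    (Val.pDeriv hδ hd (val_of_mem h2) (val_of_mem h4))

/-- The usual identity for a commutator with a composite. If `b` and `c` lift `g a` and `g (δ a)`,
then `d (f b) - f c = (d (f b) - f (δ b)) + f (δ b - c)`, and `δ b - c` lifts the value at `a` of
the derivative of `g`. -/
theorem extendDeriv_act (hδ : IsRingDerivation δ) (hd : IsModuleDerivation δ d)
    (x : F.Quotients M) (y : F.Quotients R) :
    F.extendDeriv hδ hd (act x y) =
      act (F.extendDeriv hδ hd x) y + act x (F.extendDeriv hδ hδ.isModuleDerivation y) := by
  induction x using Quotient.inductionOn with | _ f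
  induction y using Quotient.inductionOn with | _ g
  -- The first ideal provides a lift `b` of `g a` with `b` and `δ b` in the domain of `f`. The
  -- second provides a lift `c` of `g (δ a)` in that domain.
  refine quot_eq (F.inf_mem (preim_mem g.2 (F.derivIdeal_mem hδ f.2))
    (F.derivIdeal_mem hδ (preim_mem g.2 f.2))) fun a ha => ?_
  obtain ⟨⟨b, ⟨hb, hδb⟩, hab⟩, ⟨-, c, hc, hac⟩⟩ := ha
  refine ⟨_, Val.pDeriv hδ hd (hab.pComp (val_of_mem hb)) (hac.pComp (val_of_mem hc)), ?_⟩
  have h1 := hab.pComp (Val.pDeriv hδ hd (val_of_mem hb) (val_of_mem hδb))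
  have h2 := Val.pDeriv hδ hδ.isModuleDerivation hab hac
  rw [torsionFreeDeriv_mkQ, ← _root_.map_sub] at h2
  have h3 := (val_of_mem hδb).add ((val_of_mem hc).smul (-1))
  rw [neg_smul, one_smul, neg_smul, one_smul, ← sub_eq_add_neg, ← sub_eq_add_neg] at h3
  have h4 := h1.pAdd (h2.pComp h3)
  rw [sub_add_sub_cancel] at h4
  exact h4

theorem isModuleExtension_extendDeriv (F : GabrielFilter R) (hδ : IsRingDerivation δ)
    (hd : IsModuleDerivation δ d) : F.IsModuleExtension δ d (F.extendDeriv hδ hd) where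
  isModuleDerivation :=
    { map_add := extendDeriv_add hδ hd
      map_smul := fun x r => by
        rw [op_smul_def, extendDeriv_act, extendDeriv_toQuot]; rfl }
  apply_toQuot := extendDeriv_toQuot hδ hd

theorem isRingExtension_extendDeriv (F : GabrielFilter R) (hδ : IsRingDerivation δ) :
    F.IsRingExtension δ (F.extendDeriv hδ hδ.isModuleDerivation) where
  isRingDerivation :=
    { map_add := extendDeriv_add hδ hδ.isModuleDerivation
      map_mul := extendDeriv_act hδ hδ.isModuleDerivation }
  apply_toQuot := extendDeriv_toQuot hδ hδ.isModuleDerivation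

/-- Since `R` acts on `R_F` through `q_R`, the module Leibniz rule is the ring one with second
factor `q_R r`. Uniqueness and compatibility thus need proof only for modules. -/
theorem IsRingExtension.isModuleExtension {D : F.Quotients R → F.Quotients R}
    (hD : F.IsRingExtension δ D) : F.IsModuleExtension δ δ D where
  isModuleDerivation :=
    { map_add := hD.isRingDerivation.map_add
      map_smul := fun x r => by
        rw [op_smul_def, ← mul_def, hD.isRingDerivation.map_mul, hD.apply_toQuot]; rfl }
  apply_toQuot := hD.apply_toQuot

/-! ### Uniqueness and compatibility with the canonical maps -/

/-- The module of quotients is torsion-free. -/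
theorem eq_zero_of_forall_smul_eq_zero {x : F.Quotients M} {I : Submodule Rᵐᵒᵖ R}
    (hI : I ∈ F.sets) (h : ∀ a ∈ I, op a • x = 0) : x = 0 := by
  induction x using Quotient.inductionOn with | _ f
  refine quot_eq (F.inf_mem hI f.2) fun a ha => ⟨_, val_of_mem ha.2, trivial, ?_⟩
  -- As `M / t(M)` is torsion-free, `f a = 0` follows once a right ideal in `F` kills it. A `K` on
  -- which the representative of `x a` vanishes will do, because `f a * s = f (a s)`.
  refine (F.eq_zero_of_rightAnn_mem ?_).symm
  obtain ⟨K, hK, h1⟩ := exists_of_rel (Quotient.exact (h a ha.1))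
  refine F.mem_of_le hK fun s hs => ?_
  obtain ⟨y, h2, h3⟩ := h1 s hs
  obtain rfl := h3.unique (val_zero s)
  exact ((val_toQuot F a s).pComp ((val_of_mem ha.2).smul (op s))).unique h2

theorem quotMap_smul (h : F ≤ G) (r : R) (x : F.Quotients M) :
    quotMap h (op r • x) = op r • quotMap h x := quotMap_act h x (F.toQuot r)

/-- A derivation along `q₁₂` is determined by its values on the image of `M`. -/
theorem eq_of_eq_on_toQuot (h : F ≤ G) {E E' : F.Quotients M → G.Quotients M}
    (hE : ∀ x (r : R), E (op r • x) = op r • E x + op (δ r) • quotMap h x)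
    (hE' : ∀ x (r : R), E' (op r • x) = op r • E' x + op (δ r) • quotMap h x)
    (heq : ∀ m, E (F.toQuot m) = E' (F.toQuot m)) (x : F.Quotients M) : E x = E' x := by
  obtain ⟨I, hI, h1⟩ := exists_act_eq_toQuot x
  refine sub_eq_zero.1 (eq_zero_of_forall_smul_eq_zero (h hI) fun a ha => ?_)
  obtain ⟨m, hm⟩ := h1 a ha
  have h2 := heq m
  -- The term `q₁₂(x) δ(a)` is common to both Leibniz rules. Cancelling it leaves `E x * a = E' x *
  -- a`.
  rw [← hm, ← op_smul_def, hE, hE', add_left_inj] at h2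
  rw [smul_sub, h2, sub_self]

theorem quotMap_refl (x : F.Quotients M) : quotMap le_rfl x = x := by
  induction x using Quotient.inductionOn with | _ f
  refine quot_eq f.2 fun a ha => ⟨_, (val_of_mem ha).factor le_rfl, ha, ?_⟩
  obtain ⟨m, hm⟩ := Submodule.mkQ_surjective _ (f.1 ⟨a, ha⟩)
  rw [← hm]
  rfl

/-- The case `F = G` of `eq_of_eq_on_toQuot`, where `q₁₂` is the identity. -/
theorem IsModuleExtension.unique {D D' : F.Quotients M → F.Quotients M}
    (hD : F.IsModuleExtension δ d D) (hD' : F.IsModuleExtension δ d D') : D = D' := by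
  refine funext (eq_of_eq_on_toQuot (δ := δ) le_rfl (fun x r => ?_) (fun x r => ?_) fun m => ?_)
  · rw [quotMap_refl, hD.isModuleDerivation.map_smul]
  · rw [quotMap_refl, hD'.isModuleDerivation.map_smul]
  · rw [hD.apply_toQuot, hD'.apply_toQuot]

/-- Both composites are derivations along `q₁₂`, and on the image of `M` both send `q₁ m` to `q₂ (d
m)`. -/
theorem IsModuleExtension.quotMap_comm (h : F ≤ G) {D₁ : F.Quotients M → F.Quotients M}
    {D₂ : G.Quotients M → G.Quotients M} (hD₁ : F.IsModuleExtension δ d D₁)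
    (hD₂ : G.IsModuleExtension δ d D₂) (x : F.Quotients M) :
    quotMap h (D₁ x) = D₂ (quotMap h x) := by
  refine eq_of_eq_on_toQuot (δ := δ) h (E := fun x => quotMap h (D₁ x))
    (E' := fun x => D₂ (quotMap h x)) (fun x r => ?_) (fun x r => ?_) (fun m => ?_) x
  · rw [hD₁.isModuleDerivation.map_smul, quotMap_add, quotMap_smul, quotMap_smul]
  · rw [quotMap_smul, hD₂.isModuleDerivation.map_smul]
  · rw [hD₁.apply_toQuot, quotMap_toQuot, quotMap_toQuot, hD₂.apply_toQuot]

theorem moduleExtensionsAgree (h : F ≤ G) (hδ : IsRingDerivation δ)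
    (hd : IsModuleDerivation δ d) : F.ModuleExtensionsAgree G δ d :=
  ⟨h, _, _,
    ⟨F.isModuleExtension_extendDeriv hδ hd,
      fun _ hD => hD.unique (F.isModuleExtension_extendDeriv hδ hd)⟩,
    ⟨G.isModuleExtension_extendDeriv hδ hd,
      fun _ hD => hD.unique (G.isModuleExtension_extendDeriv hδ hd)⟩,
    (F.isModuleExtension_extendDeriv hδ hd).quotMap_comm h
      (G.isModuleExtension_extendDeriv hδ hd)⟩

theorem ringExtensionsAgree (h : F ≤ G) (hδ : IsRingDerivation δ) :
    F.RingExtensionsAgree G δ :=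
  have hF := F.isModuleExtension_extendDeriv hδ hδ.isModuleDerivation
  have hG := G.isModuleExtension_extendDeriv hδ hδ.isModuleDerivation
  ⟨h, _, _, ⟨F.isRingExtension_extendDeriv hδ, fun _ hD => hD.isModuleExtension.unique hF⟩,
    ⟨G.isRingExtension_extendDeriv hδ, fun _ hD => hD.isModuleExtension.unique hG⟩,
    hF.quotMap_comm h hG⟩

end DerivationsOfQuotients

/-! ### Inclusions between the filters -/

section Comparisons

variable {R : Type u} [Ring R]

/-- Density applied to the pair `b, b` with `0 ≠ b ∈ J` yields a nonzero `b * r` in `I ⊓ J`. -/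
theorem IsDenseIdeal.isEssentialIdeal {I : Submodule Rᵐᵒᵖ R} (hI : IsDenseIdeal I) :
    IsEssentialIdeal I := by
  intro J hJ
  obtain ⟨b, hb, hb0⟩ := (Submodule.ne_bot_iff _).1 hJ
  obtain ⟨r, h1, h2⟩ := hI b b hb0
  exact (Submodule.ne_bot_iff _).2 ⟨b * r, ⟨h1, rightIdeal_mul_mem hb r⟩, h2⟩

theorem lambek_le_goldie : lambek R ≤ goldie R := fun _ hI _ hF =>
  hF _ (IsDenseIdeal.isEssentialIdeal hI)

theorem isFaithful_classical (h : IsRightOre R) : (classical R).IsFaithful := by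
  refine (Submodule.eq_bot_iff _).2 fun r hr => ?_
  obtain ⟨t, ht, h1⟩ := (mem_classical_torsion_iff R h).1 hr
  exact (mul_right_mem_nonZeroDivisors_eq_zero_iff ht).1 h1

/-- The homomorphism `t R → N`, `t r ↦ y r`, for a regular element `t`. -/
noncomputable def divRegular {N : Type w} [AddCommGroup N] [Module Rᵐᵒᵖ N] {t : R}
    (ht : t ∈ nonZeroDivisors R) (y : N) : R →ₗ.[Rᵐᵒᵖ] N where
  domain := LinearMap.range (leftMulMap t)
  toFun := (leftMulMap y).comp (LinearEquiv.ofInjective (leftMulMap t) fun _ _ hrs =>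
    (mul_cancel_left_mem_nonZeroDivisors ht).1 hrs).symm.toLinearMap

theorem val_divRegular {N : Type w} [AddCommGroup N] [Module Rᵐᵒᵖ N] {t : R}
    (ht : t ∈ nonZeroDivisors R) (y : N) (r : R) : Val (divRegular ht y) (t * r) (op r • y) := by
  refine ⟨⟨r, rfl⟩, ?_⟩
  change leftMulMap y ((LinearEquiv.ofInjective (leftMulMap t) _).symm ⟨t * r, _⟩) = _
  rw [← leftMulMap_apply]
  congr 1
  exact (LinearEquiv.symm_apply_eq _).2 rfl

/-- Every `I` in the filter contains a regular `t`, and `t` becomes right invertible in the ring of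
quotients, so `I` extends to the unit ideal. The inverse is represented by `t r ↦ r + t(R)` on `t
R`. -/
theorem isPerfect_classical (h : IsRightOre R) : (classical R).IsPerfect := by
  refine isPerfect_of_one_mem_extend fun I hI => ?_
  obtain ⟨t, ht, h1⟩ := hI 1
  rw [one_mul] at h1
  have hdom : (LinearMap.range (leftMulMap t) : Submodule Rᵐᵒᵖ R) ∈ (classical R).sets := by
    intro a
    -- The Ore condition says precisely that `t R` belongs to the classical filter.
    obtain ⟨t', ht', r', h2⟩ := h a t ht
    exact ⟨t', ht', r', h2.symm⟩
  let z : (classical R).Quotients R :=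
    Quotient.mk _ ⟨divRegular ht (((classical R).torsion R).mkQ 1), hdom⟩
  have hz : (classical R).toQuot t * z = 1 := by
    refine quot_eq hdom fun x hx => ?_
    obtain ⟨r, rfl⟩ := hx
    have h3 := val_divRegular ht (((classical R).torsion R).mkQ 1) r
    rw [← _root_.map_smul, op_smul_eq_mul, one_mul] at h3
    refine ⟨_, h3.pComp (val_toQuot _ t r), ?_⟩
    have h4 := val_toQuot (classical R) (1 : R) (t * r)
    rw [op_smul_eq_mul, one_mul] at h4
    exact h4
  rw [← hz]
  exact rightIdeal_mul_mem (toQuot_mem_extend h1) z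

end Comparisons

end GabrielFilter

/-! ### The agreement of the extensions -/

theorem mainTheorem7 {R : Type u} [Ring R] {δ : R → R} (hδ : IsRingDerivation δ)
    {M : Type v} [AddCommGroup M] [Module Rᵐᵒᵖ M] {d : M → M} (hd : IsModuleDerivation δ d) :
    ((∀ F : GabrielFilter R, F.IsFaithful →
        F.RingExtensionsAgree (GabrielFilter.lambek R) δ) ∧
      (GabrielFilter.total R).RingExtensionsAgree (GabrielFilter.lambek R) δ) ∧
    ((∀ F : GabrielFilter R, F.IsDifferential → F.IsFaithful →
        F.ModuleExtensionsAgree (GabrielFilter.lambek R) δ d) ∧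
      (GabrielFilter.total R).ModuleExtensionsAgree (GabrielFilter.lambek R) δ d) ∧
    (GabrielFilter.IsRightOre R →
      (GabrielFilter.classical R).RingExtensionsAgree (GabrielFilter.lambek R) δ ∧
      (GabrielFilter.classical R).RingExtensionsAgree (GabrielFilter.total R) δ) ∧
    ((GabrielFilter.lambek R).RingExtensionsAgree (GabrielFilter.goldie R) δ ∧
      ∀ F : GabrielFilter R, F.IsFaithful →
        F.RingExtensionsAgree (GabrielFilter.goldie R) δ) := by
  have hle : ∀ F : GabrielFilter R, F.IsFaithful → F ≤ GabrielFilter.lambek R :=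
    fun F hF => (GabrielFilter.isGreatest_lambek R).2 hF
  have htot := hle _ (GabrielFilter.isGreatest_total R).1.1
  refine ⟨⟨fun F hF => GabrielFilter.ringExtensionsAgree (hle F hF) hδ,
      GabrielFilter.ringExtensionsAgree htot hδ⟩,
    ⟨fun F _ hF => GabrielFilter.moduleExtensionsAgree (hle F hF) hδ hd,
      GabrielFilter.moduleExtensionsAgree htot hδ hd⟩, fun hO => ⟨?_, ?_⟩,
    GabrielFilter.ringExtensionsAgree GabrielFilter.lambek_le_goldie hδ,
    fun F hF => GabrielFilter.ringExtensionsAgree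
      ((hle F hF).trans GabrielFilter.lambek_le_goldie) hδ⟩
  · exact GabrielFilter.ringExtensionsAgree (hle _ (GabrielFilter.isFaithful_classical hO)) hδ
  -- Perfectness is what places the classical filter below `total R`; below the Lambek filter,
  -- faithfulness is enough.
  · exact GabrielFilter.ringExtensionsAgree ((GabrielFilter.isGreatest_total R).2
      ⟨GabrielFilter.isFaithful_classical hO, GabrielFilter.isPerfect_classical hO⟩) hδ
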